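/- **Definitions.** Let $\mathcal C$ be a finite simple graph. Its *kernel* $\mathcal K$ is the multigraph whose vertices are the vertices of $\mathcal C$ of degree at least $3$, and which has one edge $e$ with ends $u,v\in V(\mathcal K)$ for each 2-path $\mathcal P_e$ of $\mathcal C$ between $u$ and $v$, i.e. each path from $u$ to $v\neq u$ in $\mathcal C$ (paths being taken up to reversal) whose inner vertices all have degree $2$; the case $u=v$ is included, where $\mathcal P_e$ is a cycle through $u$ all of whose other vertices have degree $2$, and $e$ is a loop. $V(\mathcal P_e)$ includes the end-vertices. $\Delta(\mathcal K)$ is the maximum degree of $\mathcal K$ (a loop contributes $2$ to the degree), and $\mathcal K|_U$ is the sub-multigraph induced on $U$, loops included. For an injection $\pi:V(\mathcal C)\to\mathbb R$, a *$\pi(\mathcal C)$-rigid map* is an injection $\varphi:\pi(V(\mathcal C))\to\mathbb R$ with $|\varphi(\pi(u))-\varphi(\pi(v))|=|\pi(u)-\pi(v)|$ for every $uv\in E(\mathcal C)$. For $c>0$ let $A(\pi(\mathcal C),c)$ be the event that for every $\pi(\mathcal C)$-rigid map $\varphi$ there is a set $U\subseteq V(\mathcal K)$ (which may depend on $\varphi$)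 with $|U|\ge c|V(\mathcal K)|$ and $|\varphi(\pi(u))-\varphi(\pi(v))|=|\pi(u)-\pi(v)|$ for all $u,v\in U$. **Theorem.** Let $\varepsilon\in(0,10^{-9})$ and $c\in(0,1)$ be constants. Let $n_i\to\infty$ be a sequence of natural numbers, and for each $i\in\mathbb N$ let $V_i\subseteq\mathbb R$ be a set with $|V_i|=n_i$ and $\mathcal C_i$ a finite simple graph. Write $n=n_i$, $V=V_i$, $\mathcal C=\mathcal C_i$, let $\mathcal K$ be the kernel of $\mathcal C$, put $k:=|V(\mathcal K)|$, and let $o(\cdot)$ refer to $i\to\infty$. Suppose that, for all sufficiently large $i$, the graph $\mathcal C$ is connected, has minimum degree at least $2$ and at most $n$ vertices, and satisfies: - **R1**: $\Delta(\mathcal K)\le k^{\varepsilon}$; - **R2**: $|V(\mathcal C)|\le \varepsilon k\ln k$, and $\ln k=(1-o(1))\ln n$; - **R3**: $|\{e\in E(\mathcal K): |V(\mathcal P_e)|>\tfrac{\ln n}{100}\}|\le\varepsilon k$; - **R4**: for every $U\subseteq V(\mathcal K)$ with $|U|\le\varepsilon k$, the number of edges of $\mathcal K$ incident to at least one vertex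 of $U$ is at most $10^{-9}k$; - **R5**: for every $s>0$ and all pairwise disjoint non-empty sets $S_1,\dots,S_s\subseteq V(\mathcal K)$ with $|S_j|\le ck$ for all $j$, $$\sum_{j=1}^s|E(\mathcal K|_{S_j})|\le 1.078\Big(\sum_{j=1}^s|S_j|-s\Big)+o(k),$$ where the $o(k)$ term depends only on $i$ (not on $s$ or the sets). Let $\pi:V(\mathcal C)\to V$ be a uniformly random injection. Then $A(\pi(\mathcal C),c)$ holds with high probability, i.e. $\mathbb P\big(A(\pi(\mathcal C_i),c)\big)\to1$ as $i\to\infty$. -/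

import Mathlib

namespace Rigidity

variable {W : Type*}

/-- `KernelLink C P u v`: the subgraph `P` of `C` is (the subgraph of `C` traced by) a 2-path of `C`
whose end-vertices `u` and `v` have degree at least `3`, every inner vertex having degree `2`.
Either `u ≠ v` and `P` is a path from `u` to `v`, or `u = v` and `P` is a cycle through `u`
(which is a loop of the kernel). A path and its reversal trace the same subgraph. -/
inductive KernelLink [Fintype W] (C : SimpleGraph W) [DecidableRel C.Adj] :
    C.Subgraph → W → W → Prop
  | path {u v : W} (p : C.Walk u v) (hp : p.IsPath) (huv : u ≠ v)
      (hu : 3 ≤ C.degree u) (hv : 3 ≤ C.degree v)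
      (inner : ∀ z ∈ p.support, z ≠ u → z ≠ v → C.degree z = 2) :
      KernelLink C p.toSubgraph u v
  | loop {u : W} (p : C.Walk u u) (hp : p.IsCycle) (hu : 3 ≤ C.degree u)
      (inner : ∀ z ∈ p.support, z ≠ u → C.degree z = 2) :
      KernelLink C p.toSubgraph u u

section KernelFacts

variable [Fintype W] {C : SimpleGraph W} [DecidableRel C.Adj] {P : C.Subgraph} {u v x : W}

theorem KernelLink.symm (h : KernelLink C P u v) : KernelLink C P v u := by
  cases h with
  | path p hp huv hu hv inner =>
    have := KernelLink.path p.reverse hp.reverse huv.symm hv hu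
      (fun z hz h1 h2 => inner z (by simpa using hz) h2 h1)
    simpa using this
  | loop p hp hu inner => exact KernelLink.loop p hp hu inner

theorem KernelLink.left_mem (h : KernelLink C P u v) : u ∈ P.verts := by
  cases h <;> simp

theorem KernelLink.left_degree (h : KernelLink C P u v) : 3 ≤ C.degree u := by
  cases h <;> assumption

theorem KernelLink.eq_or_eq (h : KernelLink C P u v) (hx : x ∈ P.verts) (hd : 3 ≤ C.degree x) :
    x = u ∨ x = v := by
  by_contra hne
  push Not at hne
  cases h with
  | path p hp huv hu hv inner =>
    have := inner x (by simpa using hx) hne.1 hne.2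
    omega
  | loop p hp hu inner =>
    have := inner x (by simpa using hx) hne.1
    omega

end KernelFacts

/-- The kernel of a finite graph `C`, a multigraph: its vertices are the vertices of `C` of degree
at least `3`; its edges are the 2-paths of `C` between such vertices. The edge `e` is
itself the corresponding path `𝒫_e`, as a subgraph of `C`; so `e.verts` is `V(𝒫_e)`. -/
def kernel [Fintype W] (C : SimpleGraph W) [DecidableRel C.Adj] : Graph W C.Subgraph where
  vertexSet := {v | 3 ≤ C.degree v}
  IsLink := KernelLink C
  isLink_symm := fun _ _ => ⟨fun _ _ h => h.symm⟩
  eq_or_eq_of_isLink_of_isLink := fun _ _ _ _ _ h h' => h'.eq_or_eq h.left_mem h.left_degree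
  left_mem_of_isLink := fun _ _ _ h => h.left_degree

/-- The number of vertices of the kernel. -/
noncomputable def kernelOrder [Fintype W] (C : SimpleGraph W) [DecidableRel C.Adj] : ℕ :=
  (kernel C).vertexSet.ncard

/-- The degree of a vertex of a multigraph, each loop counting twice. -/
noncomputable def multiDegree {α β : Type*} (K : Graph α β) (v : α) : ℕ :=
  (K.incidenceSet v).ncard + (K.loopSet v).ncard

/-- The number of edges of a multigraph incident to at least one vertex of `U`. -/
noncomputable def numIncident {α β : Type*} (K : Graph α β) (U : Set α) : ℕ :=
  {e : β | ∃ v ∈ U, K.Inc e v}.ncard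

/-- The number of edges of the sub-multigraph induced on `U`. -/
noncomputable def numInduced {α β : Type*} (K : Graph α β) (U : Set α) : ℕ :=
  (K.induce U).edgeSet.ncard

/-- `φ` is a `π(C)`-rigid map `π(V(C)) → ℝ`, where `π` places the vertices of `C` on the real line:
it is injective on `π(V(C))` and preserves the distance along each edge of `π(C)`.
(The values of `φ` off `π(V(C))` play no role.) -/
def IsRigidMap (C : SimpleGraph W) (π : W → ℝ) (φ : ℝ → ℝ) : Prop :=
  Set.InjOn φ (Set.range π) ∧
    ∀ u v : W, C.Adj u v → |φ (π u) - φ (π v)| = |π u - π v|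

/-- The event `A(π(C), c)`: for every `π(C)`-rigid map there is a set of at least `c |V(𝒦)|` kernel
vertices all of whose pairwise distances are preserved. -/
def EventA [Fintype W] (C : SimpleGraph W) [DecidableRel C.Adj] (π : W → ℝ) (c : ℝ) : Prop :=
  ∀ φ : ℝ → ℝ, IsRigidMap C π φ →
    ∃ U : Set W, U ⊆ (kernel C).vertexSet ∧ c * (kernelOrder C : ℝ) ≤ (U.ncard : ℝ) ∧
      ∀ u ∈ U, ∀ v ∈ U, |π u - π v| = |φ (π u) - φ (π v)|

/-- The probability of the event `E` for a uniformly random injection from `W` into the finite set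
`V` of reals. -/
noncomputable def injectionProb (W : Type*) (V : Finset ℝ) (E : (W → ℝ) → Prop) : ℝ :=
  (Nat.card {π : W ↪ V // E (fun w => (π w : ℝ))} : ℝ) / (Nat.card (W ↪ V) : ℝ)

end Rigidity

/-! Write `k` for the number of kernel vertices. A rigid map splits the edges of `C` into those
whose difference it preserves, `R`, and those whose difference it reverses, `B = C \ R`. On a
component of `R` the map is a translation, on one of `B` a reflection, so all distances inside a
component survive. If the event fails, every component of `R` and of `B` has at most `c * k` kernel
vertices.

For fixed `R`, the placement `π` is a function constant on the components of `R` plus one constant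
on those of `B`. It therefore lies in a space of dimension at most `c(R) + c(B)`, where `c(·)`
counts components, and is determined by that many coordinates. A random injection does this with
probability at most `1 / r!` whenever `r ≤ |W| - c(R) - c(B)` (`card_isFlip_mul_factorial_le`).

Sparsity of small kernel parts (R5) gives `c(R) + e(R) ≤ |W| + 0.078 k + o(k)`, and the same for `B`
(`card_connectedComponent_add_le`). Since `e(C) ≥ |W| + k / 2`, adding the two bounds leaves room
for `r = ⌊k / 4⌋`. By R2 and R4 there are only `2 ^ e(C) ≤ exp (ε k ln k + O(k))` choices of `R`,
far fewer than `r!`, and a union bound finishes (`injectionProb_not_eventA_le_exp_neg`). -/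

namespace SimpleGraph

/-- Every edge of a forest is a bridge, so deleting it creates a new component; induct down to the
edgeless graph. -/
theorem IsAcyclic.card_connectedComponent_add_ncard_edgeSet_le {V : Type*} [Finite V]
    {G : SimpleGraph V} (h : G.IsAcyclic) :
    Nat.card G.ConnectedComponent + G.edgeSet.ncard ≤ Nat.card V := by
  induction hn : G.edgeSet.ncard generalizing G with
  | zero => simpa using Nat.card_le_card_of_surjective G.connectedComponentMk Quot.mk_surjective
  | succ n ih =>
    obtain ⟨e, he⟩ : G.edgeSet.Nonempty := Set.nonempty_of_ncard_ne_zero (by omega)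
    induction e with | h u v => ?_
    have hb := isBridge_iff.1 (isAcyclic_iff_forall_isBridge.1 h he)
    have hle : G.deleteEdges {s(u, v)} ≤ G := deleteEdges_le _
    have h1 : (G.deleteEdges {s(u, v)}).edgeSet.ncard = n := by
      rw [edgeSet_deleteEdges, Set.ncard_sdiff_singleton_of_mem he]; omega
    have h2 := ih (h.anti hle) h1
    have h3 : Nat.card G.ConnectedComponent <
        Nat.card (G.deleteEdges {s(u, v)}).ConnectedComponent := by
      have hs := ConnectedComponent.surjective_map_ofLE hle
      refine lt_of_le_of_ne (Nat.card_le_card_of_surjective _ hs) fun heq => hb ?_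
      have hi := (Nat.bijective_iff_surjective_and_card _).2 ⟨hs, heq.symm⟩
      exact ConnectedComponent.exact (hi.1 (ConnectedComponent.sound
        (show G.Adj u v from he).reachable))
    omega

end SimpleGraph

namespace Rigidity

open SimpleGraph

/-! ### Kernel edges, forests and component counts -/

section KernelEdges

variable {W : Type*} [Fintype W] {C : SimpleGraph W} [DecidableRel C.Adj]

/-- The set of kernel edges whose 2-path lies in `R`. -/
def kernelEdgesIn (C : SimpleGraph W) [DecidableRel C.Adj] (R : SimpleGraph W) :
    Set C.Subgraph :=
  {P | P ∈ (kernel C).edgeSet ∧ P.edgeSet ⊆ R.edgeSet}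

theorem KernelLink.mem_edgeSet {P : C.Subgraph} {x y : W} (h : KernelLink C P x y) :
    P ∈ (kernel C).edgeSet :=
  (show (kernel C).IsLink P x y from h).edge_mem

theorem KernelLink.edgeSet_nonempty {P : C.Subgraph} {x y : W} (h : KernelLink C P x y) :
    P.edgeSet.Nonempty := by
  cases h with
  | path p hp huv hu hv inner =>
    cases p with
    | nil => exact absurd rfl huv
    | cons h p => exact ⟨_, (Walk.mem_edges_toSubgraph _).2 List.mem_cons_self⟩
  | loop p hp hu inner =>
    cases p with
    | nil => exact absurd rfl hp.ne_nil
    | cons h p => exact ⟨_, (Walk.mem_edges_toSubgraph _).2 List.mem_cons_self⟩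

theorem KernelLink.reachable {P : C.Subgraph} {x y : W} (h : KernelLink C P x y)
    {R : SimpleGraph W} (hR : P.edgeSet ⊆ R.edgeSet) : R.Reachable x y := by
  cases h with
  | path p hp huv hu hv inner =>
    exact (p.transfer R fun e he => hR (by simpa using he)).reachable
  | loop p hp hu inner => exact Reachable.refl _

/-- An inner vertex of degree other than 2 has degree at least 3, so the path can be cut short
there; a shortest such prefix is a 2-path. -/
theorem exists_kernelLink_of_isPath (hmin : ∀ v, 2 ≤ C.degree v) {u v : W} (p : C.Walk u v)
    (hp : p.IsPath) (huv : u ≠ v) (hu : 3 ≤ C.degree u) (hv : 3 ≤ C.degree v) :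
    ∃ P x y, KernelLink C P x y ∧ P.edgeSet ⊆ {e | e ∈ p.edges} := by
  classical
  induction hn : p.length using Nat.strong_induction_on generalizing v with
  | _ n ih =>
    by_cases h : ∀ z ∈ p.support, z ≠ u → z ≠ v → C.degree z = 2
    · exact ⟨_, u, v, .path p hp huv hu hv h, fun e he => by simpa using he⟩
    · push Not at h
      obtain ⟨z, hz, hzu, hzv, hd⟩ := h
      obtain ⟨P, x, y, hP, hs⟩ := ih _ (hn ▸ p.length_takeUntil_lt_length hz hzv) (p.takeUntil z hz)
        (hp.takeUntil hz) hzu.symm (by have := hmin z; omega) rfl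
      exact ⟨P, x, y, hP, hs.trans fun e he => p.edges_takeUntil_subset_edges hz he⟩

/-- A cycle whose vertices all have degree 2 is closed under adjacency, so by connectedness it would
contain `b`. -/
theorem exists_mem_support_of_isCycle (hconn : C.Connected) {b : W} (hb : 3 ≤ C.degree b)
    {u : W} (p : C.Walk u u) (hp : p.IsCycle) :
    ∃ z ∈ p.support, 3 ≤ C.degree z := by
  by_contra! hno
  have hclosed : ∀ x y, C.Adj x y → x ∈ p.support → y ∈ p.support := by
    intro x y hxy hx
    have h2 := hp.ncard_neighborSet_toSubgraph_eq_two hx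
    have hsub : p.toSubgraph.neighborSet x ⊆ C.neighborSet x := Subgraph.neighborSet_subset _ _
    have hc : (C.neighborSet x).ncard ≤ 2 := by
      have := hno x hx
      rw [← Nat.card_coe_set_eq, Nat.card_eq_fintype_card, card_neighborSet_eq_degree]; omega
    have := Set.eq_of_subset_of_ncard_le hsub (by omega)
    have hy : y ∈ p.toSubgraph.neighborSet x := this ▸ hxy
    exact p.mem_support_of_adj_toSubgraph (Subgraph.Adj.symm hy)
  have hall : ∀ w, w ∈ p.support := by
    intro w
    obtain ⟨q⟩ := hconn.preconnected u w
    have : ∀ {x y : W} (q : C.Walk x y), x ∈ p.support → y ∈ p.support := by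
      intro x y q
      induction q with
      | nil => exact id
      | cons h q ih => exact fun hx => ih (hclosed _ _ h hx)
    exact this q p.start_mem_support
  have := hno b (hall b)
  omega

theorem exists_kernelLink_of_isCycle (hconn : C.Connected) (hmin : ∀ v, 2 ≤ C.degree v) {b : W}
    (hb : 3 ≤ C.degree b) {u : W} (p : C.Walk u u) (hp : p.IsCycle) :
    ∃ P x y, KernelLink C P x y ∧ P.edgeSet ⊆ {e | e ∈ p.edges} := by
  classical
  obtain ⟨a, ha, had⟩ := exists_mem_support_of_isCycle hconn hb p hp
  have hq : (p.rotate a ha).IsCycle := hp.rotate ha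
  have hqe : ∀ e, e ∈ (p.rotate a ha).edges → e ∈ p.edges := fun e he =>
    (p.rotate_edges _ ha).mem_iff.1 he
  by_cases h : ∀ z ∈ (p.rotate a ha).support, z ≠ a → C.degree z = 2
  · exact ⟨_, a, a, .loop _ hq had h, fun e he => hqe e ((Walk.mem_edges_toSubgraph _).1 he)⟩
  · push Not at h
    obtain ⟨z, hz, hza, hd⟩ := h
    obtain ⟨P, x, y, hP, hs⟩ := exists_kernelLink_of_isPath hmin _ (hq.isPath_takeUntil hz) hza.symm
      had (by have := hmin z; omega)
    exact ⟨P, x, y, hP, hs.trans fun e he => hqe e (Walk.edges_takeUntil_subset_edges _ hz he)⟩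

/-- Deleting one edge from the 2-path of every kernel edge inside `R` leaves a forest each of whose
trees has at most one kernel vertex. -/
theorem exists_forest_le (hconn : C.Connected) (hmin : ∀ v, 2 ≤ C.degree v) {b : W}
    (hb : 3 ≤ C.degree b) {R : SimpleGraph W} (hR : R ≤ C) :
    ∃ F ≤ R, F.IsAcyclic ∧ R.edgeSet.ncard ≤ F.edgeSet.ncard + (kernelEdgesIn C R).ncard ∧
      ∀ u v, 3 ≤ C.degree u → 3 ≤ C.degree v → F.Reachable u v → u = v := by
  classical
  have hne : ∀ P : C.Subgraph, ∃ e : Sym2 W, P ∈ kernelEdgesIn C R → e ∈ P.edgeSet := by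
    intro P
    by_cases hP : P ∈ kernelEdgesIn C R
    · obtain ⟨x, y, h⟩ := (kernel C).exists_isLink_of_mem_edgeSet hP.1
      obtain ⟨e, he⟩ := KernelLink.edgeSet_nonempty h
      exact ⟨e, fun _ => he⟩
    -- A junk value: only the values of `g` on `kernelEdgesIn C R` are used.
    · exact ⟨s(b, b), fun h => absurd h hP⟩
  choose g hg using hne
  have hFR : R.deleteEdges (g '' kernelEdgesIn C R) ≤ R := deleteEdges_le _
  have key : ∀ P x y, KernelLink C P x y →
      ¬ P.edgeSet ⊆ (R.deleteEdges (g '' kernelEdgesIn C R)).edgeSet := by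
    intro P x y hP hs
    have hmem : P ∈ kernelEdgesIn C R := ⟨hP.mem_edgeSet, hs.trans (edgeSet_mono hFR)⟩
    have := hs (hg P hmem)
    rw [edgeSet_deleteEdges] at this
    exact this.2 ⟨P, hmem, rfl⟩
  refine ⟨R.deleteEdges (g '' kernelEdgesIn C R), hFR, ?_, ?_, ?_⟩
  · intro u p hp
    obtain ⟨P, x, y, hP, hs⟩ := exists_kernelLink_of_isCycle hconn hmin hb
      (p.mapLe (hFR.trans hR)) (hp.mapLe (hFR.trans hR))
    refine key P x y hP fun e he => ?_
    have := hs he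
    simp only [Set.mem_ofPred_eq, Walk.edges_mapLe_eq_edges] at this
    exact p.edges_subset_edgeSet this
  · rw [edgeSet_deleteEdges]
    have h1 := Set.ncard_le_ncard_sdiff_add_ncard R.edgeSet (g '' kernelEdgesIn C R)
      (Set.toFinite _)
    have h2 := Set.ncard_image_le (f := g) (Set.toFinite (kernelEdgesIn C R))
    omega
  · intro u v hu hv huv
    by_contra hne
    obtain ⟨p, hp⟩ := huv.exists_isPath
    obtain ⟨P, x, y, hP, hs⟩ := exists_kernelLink_of_isPath hmin
      (p.mapLe (hFR.trans hR)) (hp.mapLe (hFR.trans hR)) hne hu hv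
    refine key P x y hP fun e he => ?_
    have := hs he
    simp only [Set.mem_ofPred_eq, Walk.edges_mapLe_eq_edges] at this
    exact p.edges_subset_edgeSet this

theorem ncard_edgeSet_le_card_add (hconn : C.Connected) (hmin : ∀ v, 2 ≤ C.degree v) {b : W}
    (hb : 3 ≤ C.degree b) :
    C.edgeSet.ncard ≤ Fintype.card W + (kernel C).edgeSet.ncard := by
  obtain ⟨F, hF, hacyc, hcard, -⟩ := exists_forest_le hconn hmin hb le_rfl
  have h1 := hacyc.card_connectedComponent_add_ncard_edgeSet_le
  have h2 : (kernelEdgesIn C C).ncard ≤ (kernel C).edgeSet.ncard :=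
    Set.ncard_le_ncard (fun P hP => hP.1) (Set.toFinite _)
  rw [Nat.card_eq_fintype_card (α := W)] at h1
  omega

/-- In the degree sum each vertex contributes at least 2, and each kernel vertex at least one more.
-/
theorem two_mul_card_add_kernelOrder_le (hmin : ∀ v, 2 ≤ C.degree v) :
    2 * Fintype.card W + kernelOrder C ≤ 2 * C.edgeSet.ncard := by
  classical
  have h := C.sum_degrees_eq_twice_card_edges
  have hk : kernelOrder C = (Finset.univ.filter fun v => 3 ≤ C.degree v).card := by
    rw [← Set.ncard_coe_finset]; simp [kernelOrder, kernel]
  rw [← Set.ncard_coe_finset, coe_edgeFinset] at h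
  rw [← h, hk, Finset.card_filter, ← Finset.card_univ, Finset.card_eq_sum_ones, Finset.mul_sum,
    ← Finset.sum_add_distrib]
  refine Finset.sum_le_sum fun v _ => ?_
  have := hmin v
  split_ifs <;> omega

/-- The kernel vertices in a component of `R`. -/
def kernelPart (C : SimpleGraph W) [DecidableRel C.Adj] {R : SimpleGraph W}
    (Q : R.ConnectedComponent) : Set W :=
  {v | 3 ≤ C.degree v ∧ R.connectedComponentMk v = Q}

/-- The components of `R` which contain a kernel vertex. -/
abbrev BranchComponent (C : SimpleGraph W) [DecidableRel C.Adj] (R : SimpleGraph W) :=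
  {Q : R.ConnectedComponent // (kernelPart C Q).Nonempty}

/-- A 2-path inside `R` joins its ends within one component of `R`. -/
theorem ncard_kernelEdgesIn_le (R : SimpleGraph W) [Fintype (BranchComponent C R)] :
    (kernelEdgesIn C R).ncard ≤
      ∑ Q : BranchComponent C R, numInduced (kernel C) (kernelPart C Q.1) := by
  have hsub : kernelEdgesIn C R ⊆
      ⋃ Q : BranchComponent C R, ((kernel C).induce (kernelPart C Q.1)).edgeSet := by
    rintro P ⟨hP, hs⟩
    obtain ⟨x, y, h⟩ := (kernel C).exists_isLink_of_mem_edgeSet hP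
    have hx : x ∈ kernelPart C (R.connectedComponentMk x) := ⟨KernelLink.left_degree h, rfl⟩
    have hy : y ∈ kernelPart C (R.connectedComponentMk x) :=
      ⟨KernelLink.left_degree (KernelLink.symm h),
        ConnectedComponent.sound (KernelLink.reachable h hs).symm⟩
    exact Set.mem_iUnion.2 ⟨⟨_, x, hx⟩, x, y, h, hx, hy⟩
  exact (Set.ncard_le_ncard hsub (Set.toFinite _)).trans (Set.ncard_iUnion_le_of_fintype _)

theorem sum_ncard_kernelPart (R : SimpleGraph W) [Fintype (BranchComponent C R)] :
    ∑ Q : BranchComponent C R, (kernelPart C Q.1).ncard = kernelOrder C := by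
  classical
  rw [← finsum_eq_sum_of_fintype, ← Set.ncard_iUnion_of_finite]
  · congr 1
    ext v
    simp only [Set.mem_iUnion]
    exact ⟨fun ⟨Q, h⟩ => h.1, fun h => ⟨⟨_, v, h, rfl⟩, h, rfl⟩⟩
  · exact fun Q => Set.toFinite _
  · intro Q Q' hne
    refine Set.disjoint_left.2 fun v h h' => hne (Subtype.ext (h.2.symm.trans h'.2))

/-- Distinct components of `F` are found by taking one for each kernel vertex and one inside each
component of `R` that has no kernel vertex. -/
theorem card_connectedComponent_add_kernelOrder_le {R F : SimpleGraph W} (hF : F ≤ R)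
    (hsep : ∀ u v, 3 ≤ C.degree u → 3 ≤ C.degree v → F.Reachable u v → u = v) :
    Nat.card R.ConnectedComponent + kernelOrder C ≤
      Nat.card F.ConnectedComponent + Nat.card (BranchComponent C R) := by
  classical
  have h1 : Nat.card R.ConnectedComponent = Nat.card (BranchComponent C R) +
      Nat.card {Q : R.ConnectedComponent // ¬ (kernelPart C Q).Nonempty} := by
    rw [← Nat.card_sum, Nat.card_congr (Equiv.sumCompl _)]
  have h2 : Nat.card {Q : R.ConnectedComponent // ¬ (kernelPart C Q).Nonempty} + kernelOrder C ≤
      Nat.card F.ConnectedComponent := by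
    have : kernelOrder C = Nat.card {v // 3 ≤ C.degree v} := rfl
    rw [this, ← Nat.card_sum]
    refine Nat.card_le_card_of_injective
      (Sum.elim (fun Q => F.connectedComponentMk Q.1.out) fun v => F.connectedComponentMk v.1) ?_
    have hmix : ∀ (Q : {Q : R.ConnectedComponent // ¬ (kernelPart C Q).Nonempty})
        (v : {v // 3 ≤ C.degree v}),
        F.connectedComponentMk Q.1.out ≠ F.connectedComponentMk v.1 := by
      intro Q v h
      refine Q.2 ⟨v.1, v.2, ?_⟩
      rw [← Quot.out_eq Q.1]
      exact ConnectedComponent.sound ((ConnectedComponent.exact h).mono hF).symm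
    rintro (Q | v) (Q' | v') h
    · refine congrArg Sum.inl (Subtype.ext ?_)
      rw [← Quot.out_eq Q.1, ← Quot.out_eq Q'.1]
      exact ConnectedComponent.sound ((ConnectedComponent.exact h).mono hF)
    · exact absurd h (hmix Q v')
    · exact absurd h.symm (hmix Q' v)
    · exact congrArg Sum.inr (Subtype.ext (hsep _ _ v.2 v'.2 (ConnectedComponent.exact h)))
  omega

/-- Let `s` components of `R` contain kernel vertices and `m` kernel edges lie in `R`. The forest
gives `c(R) + e(R) ≤ |W| + m + s - k`, and `hR5` gives `m ≤ 1.078 (k - s) + δ`, so the excess over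
`|W|` is at most `0.078 (k - s) + δ`. -/
theorem card_connectedComponent_add_le (hconn : C.Connected) (hmin : ∀ v, 2 ≤ C.degree v) {b : W}
    (hb : 3 ≤ C.degree b) {R : SimpleGraph W} (hR : R ≤ C) {a δ : ℝ}
    (hsmall : ∀ Q : R.ConnectedComponent, ((kernelPart C Q).ncard : ℝ) ≤ a)
    (hR5 : ∀ s : ℕ, 0 < s → ∀ S : Fin s → Set W,
      (∀ j, S j ⊆ (kernel C).vertexSet) → (∀ j, (S j).Nonempty) →
      (Pairwise fun j j' => Disjoint (S j) (S j')) → (∀ j, ((S j).ncard : ℝ) ≤ a) →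
        (∑ j, (numInduced (kernel C) (S j) : ℝ)) ≤
          1.078 * ((∑ j, ((S j).ncard : ℝ)) - (s : ℝ)) + δ) :
    (Nat.card R.ConnectedComponent : ℝ) + R.edgeSet.ncard ≤
      Fintype.card W + 0.078 * kernelOrder C + δ := by
  classical
  have : Fintype (BranchComponent C R) := Fintype.ofFinite _
  obtain ⟨F, hF, hacyc, hcard, hsep⟩ := exists_forest_le hconn hmin hb hR
  have h1 := hacyc.card_connectedComponent_add_ncard_edgeSet_le
  have h2 := card_connectedComponent_add_kernelOrder_le hF hsep
  have h3 := ncard_kernelEdgesIn_le (C := C) R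
  have h4 := sum_ncard_kernelPart (C := C) R
  have hne : Nonempty (BranchComponent C R) := ⟨⟨R.connectedComponentMk b, b, hb, rfl⟩⟩
  let e := (Fintype.equivFin (BranchComponent C R)).symm
  have h5 := hR5 _ Fintype.card_pos (fun j => kernelPart C (e j).1) (fun j v hv => hv.1)
    (fun j => (e j).2) (fun j j' hjj => Set.disjoint_left.2 fun v h h' =>
      hjj (e.injective (Subtype.ext (h.2.symm.trans h'.2)))) (fun j => hsmall _)
  rw [e.sum_comp (fun Q : BranchComponent C R => (numInduced (kernel C) (kernelPart C Q.1) : ℝ)),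
    e.sum_comp (fun Q : BranchComponent C R => ((kernelPart C Q.1).ncard : ℝ))] at h5
  rw [Nat.card_eq_fintype_card (α := W)] at h1
  rw [Nat.card_eq_fintype_card (α := BranchComponent C R)] at h2
  rify at h1 h2 h3 h4 hcard
  have h6 : (1 : ℝ) ≤ Fintype.card (BranchComponent C R) := by exact_mod_cast Fintype.card_pos
  linarith

end KernelEdges

/-! ### Linear algebra: counting injections compatible with a given splitting -/

/-- The coordinate functionals separate the points of `L`; a maximal independent family of them
still does, and has at most `dim L` members. -/
theorem exists_finset_forall_eq_zero {W : Type*} [Finite W] (L : Submodule ℝ (W → ℝ)) :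
    ∃ T : Finset W, T.card ≤ Module.finrank ℝ L ∧ ∀ x ∈ L, (∀ t ∈ T, x t = 0) → x = 0 := by
  classical
  let ℓ : W → Module.Dual ℝ L := fun w => (LinearMap.proj w).comp L.subtype
  obtain ⟨κ, a, ha, hspan, hind⟩ := exists_linearIndependent' ℝ ℓ
  have := Finite.of_injective a ha
  have := Fintype.ofFinite κ
  refine ⟨Finset.univ.image a, Finset.card_image_le.trans ?_, fun x hx h0 => ?_⟩
  · rw [← Subspace.dual_finrank_eq, Finset.card_univ]
    exact hind.fintype_card_le_finrank
  · have hz : ∀ f ∈ Submodule.span ℝ (Set.range ℓ), f ⟨x, hx⟩ = 0 := by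
      rw [← hspan]
      intro f hf
      induction hf using Submodule.span_induction with
      | mem f hf =>
        obtain ⟨k, rfl⟩ := hf
        exact h0 _ (Finset.mem_image_of_mem a (Finset.mem_univ k))
      | zero => rfl
      | add f g _ _ hf hg => simp [hf, hg]
      | smul r f _ hf => simp [hf]
    ext w
    exact hz _ (Submodule.subset_span ⟨w, rfl⟩)

/-- `π` carries a map which preserves differences along `R` and reverses them along `B`. -/
def IsFlip {W : Type*} (R B : SimpleGraph W) (π : W → ℝ) : Prop :=
  ∃ φ : W → ℝ, (∀ u v, R.Adj u v → φ u - φ v = π u - π v) ∧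
    ∀ u v, B.Adj u v → φ u - φ v = -(π u - π v)

theorem eq_of_reachable_of_forall_adj {W α : Type*} {G : SimpleGraph W} {f : W → α}
    (hf : ∀ u v, G.Adj u v → f u = f v) {u v : W} (h : G.Reachable u v) : f u = f v := by
  obtain ⟨p⟩ := h
  induction p with
  | nil => rfl
  | cons h p ih => exact (hf _ _ h).trans ih

/-- The sums of a function constant on the components of `R` and one constant on those of `B`. -/
def flipSpace {W : Type*} (R B : SimpleGraph W) : Submodule ℝ (W → ℝ) :=
  LinearMap.range ((LinearMap.funLeft ℝ ℝ R.connectedComponentMk).coprod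
    (LinearMap.funLeft ℝ ℝ B.connectedComponentMk))

theorem finrank_flipSpace_le {W : Type*} [Finite W] (R B : SimpleGraph W) :
    Module.finrank ℝ (flipSpace R B) ≤
      Nat.card R.ConnectedComponent + Nat.card B.ConnectedComponent := by
  classical
  have := Fintype.ofFinite R.ConnectedComponent
  have := Fintype.ofFinite B.ConnectedComponent
  refine (LinearMap.finrank_range_le _).trans ?_
  rw [Module.finrank_prod, Module.finrank_fintype_fun_eq_card, Module.finrank_fintype_fun_eq_card,
    Nat.card_eq_fintype_card, Nat.card_eq_fintype_card]

theorem IsFlip.mem_flipSpace {W : Type*} {R B : SimpleGraph W} {π : W → ℝ} (h : IsFlip R B π) :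
    π ∈ flipSpace R B := by
  obtain ⟨φ, hR, hB⟩ := h
  -- Write `π = (π - φ) / 2 + (π + φ) / 2`: the first summand is constant along `R`, the second
  -- along `B`.
  refine ⟨(fun Q => (π Q.out - φ Q.out) / 2, fun Q => (π Q.out + φ Q.out) / 2), ?_⟩
  ext w
  have h1 := eq_of_reachable_of_forall_adj (f := fun w => π w - φ w)
    (fun u v h => by have := hR u v h; linarith)
    (ConnectedComponent.exact (Quot.out_eq (R.connectedComponentMk w)))
  have h2 := eq_of_reachable_of_forall_adj (f := fun w => π w + φ w)
    (fun u v h => by have := hB u v h; linarith)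
    (ConnectedComponent.exact (Quot.out_eq (B.connectedComponentMk w)))
  simp only [LinearMap.coprod_apply, Pi.add_apply, LinearMap.funLeft_apply] at h1 h2 ⊢
  linarith

theorem card_isFlip_mul_factorial_le {W : Type*} [Fintype W] (R B : SimpleGraph W) (V : Finset ℝ)
    {r : ℕ} (hV : Fintype.card W ≤ V.card)
    (hr : Nat.card R.ConnectedComponent + Nat.card B.ConnectedComponent + r ≤ Fintype.card W) :
    Nat.card {π : W ↪ V // IsFlip R B fun w => (π w : ℝ)} * r.factorial ≤
      Nat.card (W ↪ V) := by
  classical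
  obtain ⟨T, hT, hzero⟩ := exists_finset_forall_eq_zero (flipSpace R B)
  have hTc : T.card ≤ Nat.card R.ConnectedComponent + Nat.card B.ConnectedComponent :=
    hT.trans (finrank_flipSpace_le R B)
  have h1 : Nat.card {π : W ↪ V // IsFlip R B fun w => (π w : ℝ)} ≤ V.card.descFactorial T.card := by
    have : Nat.card (T ↪ V) = V.card.descFactorial T.card := by
      simp [Nat.card_eq_fintype_card, Fintype.card_embedding_eq]
    rw [← this]
    refine Nat.card_le_card_of_injective
      (fun π => (Function.Embedding.subtype (· ∈ T)).trans π.1) fun π π' h => ?_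
    have h0 := hzero _ (Submodule.sub_mem _ π.2.mem_flipSpace π'.2.mem_flipSpace) fun t ht => by
      have := DFunLike.congr_fun h ⟨t, ht⟩
      simp only [Function.Embedding.trans_apply, Function.Embedding.subtype_apply] at this
      simp [this]
    ext w
    simpa [sub_eq_zero] using congrFun h0 w
  -- Once the values on `T` are fixed, a general injection still has at least `r!` extensions,
  -- whereas a flip has at most one.
  have h2 : r.factorial ≤ (V.card - T.card).descFactorial (Fintype.card W - T.card) := by
    calc r.factorial ≤ (Fintype.card W - T.card).factorial := Nat.factorial_le (by omega)
      _ = (Fintype.card W - T.card).descFactorial (Fintype.card W - T.card) :=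
        (Nat.descFactorial_self _).symm
      _ ≤ _ := Nat.descFactorial_le _ (by omega)
  calc _ ≤ V.card.descFactorial T.card *
        (V.card - T.card).descFactorial (Fintype.card W - T.card) := Nat.mul_le_mul h1 h2
    _ = V.card.descFactorial (Fintype.card W) := by
        rw [mul_comm, Nat.descFactorial_mul_descFactorial (by omega)]
    _ = _ := by simp [Nat.card_eq_fintype_card, Fintype.card_embedding_eq]

/-! ### Union bound over the splittings of the edge set -/

section

variable {W : Type*} [Fintype W] {C : SimpleGraph W} [DecidableRel C.Adj]

theorem exists_isFlip_of_not_eventA {π : W → ℝ} {c : ℝ} (h : ¬ EventA C π c) :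
    ∃ R ≤ C, IsFlip R (C \ R) π ∧
      (∀ Q : R.ConnectedComponent, ((kernelPart C Q).ncard : ℝ) ≤ c * kernelOrder C) ∧
      ∀ Q : (C \ R).ConnectedComponent, ((kernelPart C Q).ncard : ℝ) ≤ c * kernelOrder C := by
  unfold EventA at h
  push Not at h
  obtain ⟨φ, ⟨-, hφ⟩, hU⟩ := h
  let R : SimpleGraph W :=
    { Adj u v := C.Adj u v ∧ φ (π u) - φ (π v) = π u - π v
      symm := ⟨fun u v h => ⟨h.1.symm, by linarith [h.2]⟩⟩
      loopless := ⟨fun u h => h.1.ne rfl⟩ }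
  have hR : ∀ u v, R.Adj u v → φ (π u) - φ (π v) = π u - π v := fun u v h => h.2
  have hB : ∀ u v, (C \ R).Adj u v → φ (π u) - φ (π v) = -(π u - π v) := by
    rintro u v ⟨h, hn⟩
    exact (abs_eq_abs.1 (hφ u v h)).resolve_left fun h' => hn ⟨h, h'⟩
  have aux : ∀ U : Set W, U ⊆ (kernel C).vertexSet →
      (∀ u ∈ U, ∀ v ∈ U, |π u - π v| = |φ (π u) - φ (π v)|) →
      (U.ncard : ℝ) ≤ c * kernelOrder C := by
    intro U hU1 hU2
    by_contra! hlt
    obtain ⟨u, hu, v, hv, hne⟩ := hU U hU1 hlt.le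
    exact hne (hU2 u hu v hv)
  refine ⟨R, fun u v h => h.1, ⟨fun w => φ (π w), hR, hB⟩, fun Q => ?_, fun Q => ?_⟩
  · refine aux _ (fun v hv => hv.1) fun u hu v hv => ?_
    have := eq_of_reachable_of_forall_adj (f := fun w => φ (π w) - π w)
      (fun u v h => by have := hR u v h; linarith)
      (ConnectedComponent.exact (hu.2.trans hv.2.symm))
    congr 1
    linarith
  · refine aux _ (fun v hv => hv.1) fun u hu v hv => ?_
    have := eq_of_reachable_of_forall_adj (f := fun w => φ (π w) + π w)
      (fun u v h => by have := hB u v h; linarith)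
      (ConnectedComponent.exact (hu.2.trans hv.2.symm))
    rw [← abs_neg]
    congr 1
    linarith

theorem injectionProb_add_compl {V : Finset ℝ} (hV : Fintype.card W ≤ V.card)
    (E : (W → ℝ) → Prop) : injectionProb W V E + injectionProb W V (fun π => ¬ E π) = 1 := by
  classical
  have hpos : 0 < Nat.card (W ↪ V) := by
    rw [Nat.card_eq_fintype_card, Fintype.card_embedding_eq, Fintype.card_coe]
    exact Nat.descFactorial_pos.2 hV
  rw [injectionProb, injectionProb, ← add_div, div_eq_one_iff_eq (by positivity), ← Nat.cast_add,
    ← Nat.card_sum, Nat.card_congr (Equiv.sumCompl _)]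

theorem injectionProb_not_eventA_mul_factorial_le {V : Finset ℝ} {c : ℝ} {r : ℕ}
    (hV : Fintype.card W ≤ V.card)
    (hr : ∀ R ≤ C, (∀ Q : R.ConnectedComponent, ((kernelPart C Q).ncard : ℝ) ≤ c * kernelOrder C) →
      (∀ Q : (C \ R).ConnectedComponent, ((kernelPart C Q).ncard : ℝ) ≤ c * kernelOrder C) →
      Nat.card R.ConnectedComponent + Nat.card (C \ R).ConnectedComponent + r ≤ Fintype.card W) :
    injectionProb W V (fun π => ¬ EventA C π c) * r.factorial ≤ 2 ^ C.edgeSet.ncard := by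
  classical
  have hpos : 0 < Nat.card (W ↪ V) := by
    rw [Nat.card_eq_fintype_card, Fintype.card_embedding_eq, Fintype.card_coe]
    exact Nat.descFactorial_pos.2 hV
  have hcard : Nat.card {R : SimpleGraph W // R ≤ C} ≤ 2 ^ C.edgeSet.ncard := by
    rw [← Set.ncard_powerset _ (Set.toFinite _), ← Nat.card_coe_set_eq]
    exact Nat.card_le_card_of_injective (fun R => ⟨R.1.edgeSet, edgeSet_mono R.2⟩)
      fun R R' h => Subtype.ext (edgeSet_injective (congrArg Subtype.val h))
  have := Fintype.ofFinite {R : SimpleGraph W // R ≤ C}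
  have hunion : Nat.card {π : W ↪ V // ¬ EventA C (fun w => (π w : ℝ)) c} * r.factorial ≤
      Nat.card {R : SimpleGraph W // R ≤ C} * Nat.card (W ↪ V) := by
    let A : {R : SimpleGraph W // R ≤ C} → Set (W ↪ V) := fun R =>
      {π | ¬ EventA C (fun w => (π w : ℝ)) c ∧ IsFlip R.1 (C \ R.1) (fun w => (π w : ℝ)) ∧
        (∀ Q : R.1.ConnectedComponent, ((kernelPart C Q).ncard : ℝ) ≤ c * kernelOrder C) ∧
        ∀ Q : (C \ R.1).ConnectedComponent, ((kernelPart C Q).ncard : ℝ) ≤ c * kernelOrder C}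
    have hA : ∀ R, (A R).ncard * r.factorial ≤ Nat.card (W ↪ V) := by
      intro R
      -- The rank bound `hr` needs small components; a nonempty `A R` supplies them.
      by_cases hne : (A R).Nonempty
      · obtain ⟨π, -, -, h1, h2⟩ := hne
        refine le_trans ?_ (card_isFlip_mul_factorial_le R.1 (C \ R.1) V hV (hr _ R.2 h1 h2))
        exact Nat.mul_le_mul_right _ (Set.ncard_le_ncard (fun π h => h.2.1) (Set.toFinite _))
      · rw [Set.not_nonempty_iff_eq_empty.1 hne]; simp
    have hsub : {π : W ↪ V | ¬ EventA C (fun w => (π w : ℝ)) c} ⊆ ⋃ R, A R := by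
      intro π h
      obtain ⟨R, hR, h1, h2, h3⟩ := exists_isFlip_of_not_eventA h
      exact Set.mem_iUnion.2 ⟨⟨R, hR⟩, h, h1, h2, h3⟩
    calc _ ≤ (∑ R, (A R).ncard) * r.factorial := Nat.mul_le_mul_right _
          ((Set.ncard_le_ncard hsub (Set.toFinite _)).trans (Set.ncard_iUnion_le_of_fintype _))
      _ ≤ ∑ R : {R : SimpleGraph W // R ≤ C}, Nat.card (W ↪ V) := by
          rw [Finset.sum_mul]; exact Finset.sum_le_sum fun R _ => hA R
      _ = _ := by simp [Nat.card_eq_fintype_card]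
  rw [injectionProb, div_mul_eq_mul_div, div_le_iff₀ (by positivity)]
  exact_mod_cast hunion.trans (Nat.mul_le_mul_right _ hcard)

end

open Filter

/-! ### Quantitative estimates for the kernel and the failure probability -/

section

variable {W : Type*} [Fintype W] {C : SimpleGraph W} [DecidableRel C.Adj]

theorem numIncident_union_le (U U' : Set W) :
    numIncident (kernel C) (U ∪ U') ≤ numIncident (kernel C) U + numIncident (kernel C) U' := by
  refine (Set.ncard_le_ncard (t := {e | ∃ v ∈ U, (kernel C).Inc e v} ∪
    {e | ∃ v ∈ U', (kernel C).Inc e v}) ?_ (Set.toFinite _)).trans (Set.ncard_union_le _ _)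
  rintro e ⟨v, hv | hv, he⟩
  exacts [Or.inl ⟨v, hv, he⟩, Or.inr ⟨v, hv, he⟩]

theorem numIncident_le_mul {t : ℕ} {a : ℝ}
    (h : ∀ U ⊆ (kernel C).vertexSet, U.ncard ≤ t → (numIncident (kernel C) U : ℝ) ≤ a) (N : ℕ)
    (U : Set W) (hU : U ⊆ (kernel C).vertexSet) (hcard : U.ncard ≤ N * t) :
    (numIncident (kernel C) U : ℝ) ≤ N * a := by
  induction N generalizing U with
  | zero =>
    have : U = ∅ := (Set.ncard_eq_zero (Set.toFinite _)).1 (by omega)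
    simp [this, numIncident]
  | succ N ih =>
    by_cases hle : U.ncard ≤ t
    · have h1 := h U hU hle
      have h0 : (0 : ℝ) ≤ a := (Nat.cast_nonneg _).trans h1
      push_cast
      nlinarith [mul_nonneg (Nat.cast_nonneg (α := ℝ) N) h0]
    · obtain ⟨U', hsub, hc⟩ := Set.exists_subset_card_eq (s := U) (n := t) (by omega)
      have h1 := h U' (hsub.trans hU) hc.le
      have h2 := ih (U \ U') (Set.sdiff_subset.trans hU) (by
        rw [Set.ncard_sdiff hsub (Set.toFinite _), hc, Nat.sub_le_iff_le_add]
        linarith [Nat.succ_mul N t])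
      have h3 := numIncident_union_le (C := C) U' (U \ U')
      rw [Set.union_sdiff_cancel hsub] at h3
      rify at h3
      push_cast
      linarith

/-- Boundedly many sets of size at most `ε k` cover the kernel vertices, and every kernel edge is
incident to one of them. -/
theorem ncard_edgeSet_kernel_le {ε a : ℝ} (hε : 0 < ε) (hk : 1 ≤ ε * kernelOrder C)
    (h : ∀ U ⊆ (kernel C).vertexSet, (U.ncard : ℝ) ≤ ε * kernelOrder C →
      (numIncident (kernel C) U : ℝ) ≤ a) :
    ((kernel C).edgeSet.ncard : ℝ) ≤ ⌈2 / ε⌉₊ * a := by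
  -- As `ε k ≥ 1`, rounding down loses at most a factor 2, hence `2 / ε` rather than `1 / ε`.
  have hfl : (⌊ε * kernelOrder C⌋₊ : ℝ) ≥ ε * kernelOrder C / 2 := by
    have h1 := Nat.lt_floor_add_one (ε * kernelOrder C)
    have h2 : (1 : ℝ) ≤ ⌊ε * kernelOrder C⌋₊ := by exact_mod_cast Nat.le_floor (by simpa using hk)
    linarith
  have := numIncident_le_mul (C := C) (t := ⌊ε * kernelOrder C⌋₊) (a := a)
    (fun U hU hc => h U hU ((Nat.cast_le.2 hc).trans (Nat.floor_le (by linarith))))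
    ⌈2 / ε⌉₊ _ subset_rfl (by
      have h1 : 2 / ε * (ε * kernelOrder C / 2) ≤ ⌈2 / ε⌉₊ * ⌊ε * kernelOrder C⌋₊ :=
        mul_le_mul (Nat.le_ceil _) hfl (by positivity) (by positivity)
      have h2 : 2 / ε * (ε * kernelOrder C / 2) = kernelOrder C := by field_simp
      rw [h2] at h1
      exact_mod_cast h1)
  refine le_trans (Nat.cast_le.2 (Set.ncard_le_ncard (fun P hP => ?_) (Set.toFinite _))) this
  obtain ⟨x, y, hxy⟩ := (kernel C).exists_isLink_of_mem_edgeSet hP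
  exact ⟨x, hxy.left_mem, hxy.inc_left⟩

theorem card_connectedComponent_add_card_add_le (hconn : C.Connected)
    (hmin : ∀ v, 2 ≤ C.degree v) (hk : 0 < kernelOrder C) {c δ : ℝ}
    (hδ : δ ≤ 0.02 * kernelOrder C)
    (hR5 : ∀ s : ℕ, 0 < s → ∀ S : Fin s → Set W,
      (∀ j, S j ⊆ (kernel C).vertexSet) → (∀ j, (S j).Nonempty) →
      (Pairwise fun j j' => Disjoint (S j) (S j')) →
      (∀ j, ((S j).ncard : ℝ) ≤ c * kernelOrder C) →
        (∑ j, (numInduced (kernel C) (S j) : ℝ)) ≤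
          1.078 * ((∑ j, ((S j).ncard : ℝ)) - (s : ℝ)) + δ)
    {R : SimpleGraph W} (hR : R ≤ C)
    (h1 : ∀ Q : R.ConnectedComponent, ((kernelPart C Q).ncard : ℝ) ≤ c * kernelOrder C)
    (h2 : ∀ Q : (C \ R).ConnectedComponent, ((kernelPart C Q).ncard : ℝ) ≤ c * kernelOrder C) :
    Nat.card R.ConnectedComponent + Nat.card (C \ R).ConnectedComponent + kernelOrder C / 4 ≤
      Fintype.card W := by
  obtain ⟨b, hb⟩ := Set.nonempty_of_ncard_ne_zero hk.ne'
  have e1 := card_connectedComponent_add_le hconn hmin hb hR h1 hR5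
  have e2 := card_connectedComponent_add_le hconn hmin hb sdiff_le h2 hR5
  have e3 : (C \ R).edgeSet.ncard + R.edgeSet.ncard = C.edgeSet.ncard := by
    rw [edgeSet_sdiff]
    exact Set.ncard_sdiff_add_ncard_of_subset (edgeSet_mono hR) (Set.toFinite _)
  have e4 := two_mul_card_add_kernelOrder_le hmin
  have e5 : ((kernelOrder C / 4 : ℕ) : ℝ) ≤ kernelOrder C / 4 := by
    exact_mod_cast Nat.cast_div_le (α := ℝ)
  generalize kernelOrder C / 4 = r at e5 ⊢
  rify at e3 e4 ⊢
  -- Adding `e1` and `e2` and using `e4`, the slack is `(0.5 - 2 * 0.078 - 2 * 0.02) k = 0.304 k`,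
  -- above `k / 4`.
  linarith

theorem injectionProb_not_eventA_le_exp_neg {ε c δ a : ℝ} (hε : 0 < ε) (hε' : ε ≤ 0.01)
    {V : Finset ℝ} (hV : Fintype.card W ≤ V.card) (hconn : C.Connected)
    (hmin : ∀ v, 2 ≤ C.degree v) (hk1 : 1 ≤ ε * kernelOrder C) (hk8 : 8 ≤ kernelOrder C)
    (hlog : 10 * (⌈2 / ε⌉₊ + 2) ≤ Real.log (kernelOrder C))
    (hδ : δ ≤ 0.02 * kernelOrder C) (ha : a ≤ kernelOrder C)
    (hR2 : (Fintype.card W : ℝ) ≤ ε * kernelOrder C * Real.log (kernelOrder C))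
    (hR4 : ∀ U ⊆ (kernel C).vertexSet, (U.ncard : ℝ) ≤ ε * kernelOrder C →
      (numIncident (kernel C) U : ℝ) ≤ a)
    (hR5 : ∀ s : ℕ, 0 < s → ∀ S : Fin s → Set W,
      (∀ j, S j ⊆ (kernel C).vertexSet) → (∀ j, (S j).Nonempty) →
      (Pairwise fun j j' => Disjoint (S j) (S j')) →
      (∀ j, ((S j).ncard : ℝ) ≤ c * kernelOrder C) →
        (∑ j, (numInduced (kernel C) (S j) : ℝ)) ≤
          1.078 * ((∑ j, ((S j).ncard : ℝ)) - (s : ℝ)) + δ) :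
    injectionProb W V (fun π => ¬ EventA C π c) ≤ Real.exp (-kernelOrder C) := by
  have hmain := injectionProb_not_eventA_mul_factorial_le (C := C) (c := c)
    (r := kernelOrder C / 4) hV fun R hR h1 h2 =>
      card_connectedComponent_add_card_add_le hconn hmin (by omega) hδ hR5 hR h1 h2
  obtain ⟨b, hb⟩ : (kernel C).vertexSet.Nonempty :=
    Set.nonempty_of_ncard_ne_zero (by change kernelOrder C ≠ 0; omega)
  have hE := ncard_edgeSet_le_card_add hconn hmin hb
  have hK := ncard_edgeSet_kernel_le hε hk1 hR4
  set k := kernelOrder C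
  set N := ⌈2 / ε⌉₊
  have hkr : k ≤ 8 * (k / 4) := by omega
  generalize k / 4 = r at hkr hmain
  have hr : (k : ℝ) / 8 ≤ r := by
    rify at hkr
    linarith
  have hk0 : (0 : ℝ) < k := by exact_mod_cast (by omega : 0 < k)
  have hL : 0 ≤ Real.log k := le_trans (by positivity) hlog
  -- A single term of the exponential series: `k ^ r / r! ≤ exp k`.
  have hfact : Real.exp (r * Real.log k - k) ≤ r.factorial := by
    have h1 := Real.pow_div_factorial_le_exp (k : ℝ) hk0.le r
    have h2 : Real.exp (r * Real.log k) = (k : ℝ) ^ r := by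
      rw [Real.exp_nat_mul, Real.exp_log hk0]
    rw [Real.exp_sub, h2, div_le_iff₀ (Real.exp_pos _)]
    rwa [div_le_iff₀ (by positivity), mul_comm] at h1
  have hpow : (2 : ℝ) ^ C.edgeSet.ncard ≤ Real.exp (ε * k * Real.log k + N * k) := by
    have h2 : (2 : ℝ) ≤ Real.exp 1 := by linarith [Real.add_one_le_exp (1 : ℝ)]
    calc (2 : ℝ) ^ C.edgeSet.ncard ≤ Real.exp 1 ^ C.edgeSet.ncard := by gcongr
      _ = Real.exp C.edgeSet.ncard := by rw [← Real.exp_nat_mul, mul_one]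
      _ ≤ _ := by
        refine Real.exp_le_exp.2 ?_
        rify at hE
        have : (N : ℝ) * a ≤ N * k := by gcongr
        linarith
  have hp0 : 0 ≤ injectionProb W V (fun π => ¬ EventA C π c) := by
    unfold injectionProb; positivity
  -- As `r ≥ k / 8` and `ε ≤ 0.01`, the gain is at least `0.115 k ln k`, which `hlog` makes larger
  -- than `(N + 2) k`.
  have hexp : ε * k * Real.log k + N * k ≤ -k + (r * Real.log k - k) := by
    have h1 : (k : ℝ) / 8 * Real.log k ≤ r * Real.log k := by gcongr
    have h2 : ε * k * Real.log k ≤ 0.01 * k * Real.log k := by gcongr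
    have h3 : (k : ℝ) * (10 * (N + 2)) ≤ k * Real.log k := by gcongr
    nlinarith
  refine le_of_mul_le_mul_right (a := Real.exp (r * Real.log k - k)) ?_ (Real.exp_pos _)
  calc _ ≤ injectionProb W V (fun π => ¬ EventA C π c) * r.factorial := by gcongr
    _ ≤ _ := hmain.trans hpow
    _ ≤ _ := by rw [← Real.exp_add]; exact Real.exp_le_exp.2 hexp

end

/-! ### Passage to the limit -/

theorem tendsto_atTop_of_tendsto_log_div_log {n k : ℕ → ℕ} (hn : Tendsto n atTop atTop)
    (h : Tendsto (fun i => Real.log (k i) / Real.log (n i)) atTop (nhds 1)) :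
    Tendsto k atTop atTop := by
  have hlog : Tendsto (fun i => Real.log (n i)) atTop atTop :=
    Real.tendsto_log_atTop.comp (tendsto_natCast_atTop_atTop.comp hn)
  have hmul := h.pos_mul_atTop one_pos hlog
  refine tendsto_natCast_atTop_iff (R := ℝ) |>.1 (tendsto_atTop_mono' _ ?_ hmul)
  filter_upwards [hlog.eventually_gt_atTop 0] with i hi
  rw [div_mul_cancel₀ _ hi.ne']
  exact Real.log_le_self (Nat.cast_nonneg _)

end Rigidity

theorem mainTheorem4
    (ε c : ℝ) (hε : ε ∈ Set.Ioo (0 : ℝ) ((10 : ℝ) ^ (-9 : ℤ))) (hc : c ∈ Set.Ioo (0 : ℝ) 1)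
    (n : ℕ → ℕ) (hn : Filter.Tendsto n Filter.atTop Filter.atTop)
    (V : ℕ → Finset ℝ) (hV : ∀ i, (V i).card = n i)
    (W : ℕ → Type*) [∀ i, Fintype (W i)]
    (C : ∀ i, SimpleGraph (W i)) [∀ i, DecidableRel (C i).Adj]
    (hconn : ∀ᶠ i in Filter.atTop, (C i).Connected)
    (hmin : ∀ᶠ i in Filter.atTop, ∀ v, 2 ≤ (C i).degree v)
    (hsize : ∀ᶠ i in Filter.atTop, Fintype.card (W i) ≤ n i)
    (k : ℕ → ℕ) (hk : ∀ i, k i = Rigidity.kernelOrder (C i))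
    (hR1 : ∀ᶠ i in Filter.atTop, ∀ v ∈ (Rigidity.kernel (C i)).vertexSet,
      (Rigidity.multiDegree (Rigidity.kernel (C i)) v : ℝ) ≤ (k i : ℝ) ^ ε)
    (hR2 : ∀ᶠ i in Filter.atTop,
      (Fintype.card (W i) : ℝ) ≤ ε * (k i : ℝ) * Real.log (k i))
    (hR2' : Filter.Tendsto (fun i => Real.log (k i) / Real.log (n i)) Filter.atTop (nhds 1))
    (hR3 : ∀ᶠ i in Filter.atTop,
      ({e ∈ (Rigidity.kernel (C i)).edgeSet |
        Real.log (n i) / 100 < (e.verts.ncard : ℝ)}.ncard : ℝ) ≤ ε * (k i : ℝ))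
    (hR4 : ∀ᶠ i in Filter.atTop, ∀ U ⊆ (Rigidity.kernel (C i)).vertexSet,
      (U.ncard : ℝ) ≤ ε * (k i : ℝ) →
        (Rigidity.numIncident (Rigidity.kernel (C i)) U : ℝ) ≤ (10 : ℝ) ^ (-9 : ℤ) * (k i : ℝ))
    (err : ℕ → ℝ) (herr : err =o[Filter.atTop] fun i => (k i : ℝ))
    (hR5 : ∀ᶠ i in Filter.atTop, ∀ s : ℕ, 0 < s → ∀ S : Fin s → Set (W i),
      (∀ j, S j ⊆ (Rigidity.kernel (C i)).vertexSet) → (∀ j, (S j).Nonempty) →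
      (Pairwise fun j j' => Disjoint (S j) (S j')) →
      (∀ j, ((S j).ncard : ℝ) ≤ c * (k i : ℝ)) →
        (∑ j, (Rigidity.numInduced (Rigidity.kernel (C i)) (S j) : ℝ)) ≤
          1.078 * ((∑ j, ((S j).ncard : ℝ)) - (s : ℝ)) + err i) :
    Filter.Tendsto
      (fun i => Rigidity.injectionProb (W i) (V i) fun π => Rigidity.EventA (C i) π c)
      Filter.atTop (nhds 1) := by
  have hk_top := Rigidity.tendsto_atTop_of_tendsto_log_div_log hn hR2'
  have hkR : Filter.Tendsto (fun i => (k i : ℝ)) Filter.atTop Filter.atTop :=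
    tendsto_natCast_atTop_atTop.comp hk_top
  have hbad : Filter.Tendsto (fun i => Rigidity.injectionProb (W i) (V i)
      fun π => ¬ Rigidity.EventA (C i) π c) Filter.atTop (nhds 0) := by
    refine squeeze_zero' (Filter.Eventually.of_forall fun i => ?_) ?_
      (Real.tendsto_exp_neg_atTop_nhds_zero.comp hkR)
    · unfold Rigidity.injectionProb; positivity
    filter_upwards [hconn, hmin, hsize, hR2, hR4, hR5, hk_top.eventually_ge_atTop 8,
      (hkR.const_mul_atTop hε.1).eventually_ge_atTop 1,
      (Real.tendsto_log_atTop.comp hkR).eventually_ge_atTop (10 * (⌈2 / ε⌉₊ + 2)),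
      herr.bound (show (0 : ℝ) < 0.02 by norm_num)] with i h1 h2 h3 h4 h5 h6 h7 h8 h9 h10
    simp only [Function.comp_apply] at h9 ⊢
    rw [Real.norm_eq_abs, Real.norm_natCast] at h10
    have h11 := (le_abs_self _).trans h10
    have hε1 : ε ≤ 0.01 := hε.2.le.trans (by norm_num)
    simp only [hk i] at h4 h5 h6 h7 h8 h9 h11 ⊢
    exact Rigidity.injectionProb_not_eventA_le_exp_neg hε.1 hε1 ((hV i).symm ▸ h3) h1 h2 h8 h7 h9
      h11 (mul_le_of_le_one_left (Nat.cast_nonneg _) (by norm_num)) h4 h5 h6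
  have hlim := (tendsto_const_nhds (x := (1 : ℝ))).sub hbad
  rw [sub_zero] at hlim
  refine hlim.congr' ?_
  filter_upwards [hsize] with i hi
  rw [← Rigidity.injectionProb_add_compl ((hV i).symm ▸ hi) fun π => Rigidity.EventA (C i) π c]
  ring
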